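/- Fix an integer $k\ge 1$. The input is a uniformly random permutation $(e_1,\dots,e_n)$ of $\{1,\dots,n\}$. For $n>k$, let $p_1<\dots<p_k$ be the elements $e_1,\dots,e_k$ in sorted order (the pivots) and put $p_0=0$, $p_{k+1}=n+1$. An element $x$ among $e_{k+1},\dots,e_n$ belongs to group $A_h$ ($0\le h\le k$) if $p_h<x<p_{h+1}$; let $a_h$ be the number of elements of $A_h$. For $n\le k$ nothing has to be classified. A comparison tree $\lambda$ is a binary search tree with inner nodes $p_1,\dots,p_k$ (in inorder) and leaves $A_0,\dots,A_k$ (from left to right). Classifying an element of $A_h$ with $\lambda$ takes $\mathrm{depth}_\lambda(A_h)$ comparisons, and $\mathrm{cost}^\lambda(b_0,\dots,b_k)=\sum_{h=0}^k \mathrm{depth}_\lambda(A_h)\, b_h$. A classification tree is a $(k+1)$-way tree with $n-k$ levels of inner nodes and one leaf level, whose edges out of a node are labeled $0,\dots,k$. Each inner node $v$ carries an index $i(v)\in\{k+1,\dots,n\}$ and a comparison tree $\lambda(v)$, and every index occurs exactly once on each path from the root to a leaf. At $v$ the element $e_{i(v)}$ is classified with $\lambda(v)$, and the edge labeled by its group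 is followed. For a node $v$ let $a_h^v$ be the number of edges labeled $h$ on the path from the root to $v$. The comparison count of an input is the total number of comparisons made in this way to classify $e_{k+1},\dots,e_n$. Strategy $\mathcal O_k$: knowing $a_0,\dots,a_k$ (so that the classification tree may depend on them), $\lambda(v)$ is a comparison tree that minimizes $\mathrm{cost}^{\lambda}(a_0-a_0^v,\dots,a_k-a_k^v)$ over all comparison trees $\lambda$, for every inner node $v$ with $a_h^v\le a_h$ for all $h$. Strategy $\mathcal C_k$: the classification tree does not depend on $a_0,\dots,a_k$, and at every inner node $v$, $\lambda(v)$ is a comparison tree that minimizes $\mathrm{cost}^{\lambda}(a_0^v,\dots,a_k^v)$ over all comparison trees $\lambda$. In both strategies the order of classification (the indices $i(v)$) and the way ties are broken are arbitrary. **Theorem.** For every $k\ge1$, strategy $\mathcal C_k$ is asymptotically optimal: there is a constant $\varepsilon>0$ such that the expected comparison counts of $\mathcal C_k$ and of $\mathcal O_k$ on inputs of length $n$ differ by at most $O(n^{1-\varepsilon})$. More precisely, they differ by at most $O(n^{11/12})$. The constants in the $O$-terms depend only on $k$; they do not depend on $n$, on the order of classification, or on how ties are broken in either strategy. -/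

import Mathlib

open scoped BigOperators

namespace MultiPivot

/-! ### Comparison trees -/

/-- A comparison tree for `k` pivots: a binary tree with `k` inner nodes. The labels carry no
information: the inner nodes are `p_1, …, p_k` in inorder and the `k + 1` leaves (`BinaryTree.nil`)
are `A_0, …, A_k` from left to right. -/
abbrev ComparisonTree (k : ℕ) : Type := {t : BinaryTree Unit // t.numNodes = k}

/-- The depth of the `h`-th leaf (counted from the left, starting with `0`) of a binary tree.
The left subtree `l` of a node has the leaves `0, …, l.numNodes`. -/
def leafDepth : BinaryTree Unit → ℕ → ℕ
  | .nil, _ => 0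
  | .node _ l r, h =>
      if h ≤ l.numNodes then leafDepth l h + 1 else leafDepth r (h - (l.numNodes + 1)) + 1

/-- `depth_t(A_h)`: the number of comparisons that searching in the comparison tree `t` makes for an
element of the group `A_h`. -/
def ComparisonTree.depth {k : ℕ} (t : ComparisonTree k) (h : Fin (k + 1)) : ℕ :=
  leafDepth t.1 h

/-- `cost^t(a_0, …, a_k) = ∑ depth_t(A_h) * a_h`. -/
def ComparisonTree.cost {k : ℕ} (t : ComparisonTree k) (a : Fin (k + 1) → ℕ) : ℕ :=
  ∑ h, t.depth h * a h

/-- `t` is a comparison tree of minimum cost with respect to the group counts `a`. -/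
def ComparisonTree.IsCostMinimal {k : ℕ} (t : ComparisonTree k) (a : Fin (k + 1) → ℕ) : Prop :=
  ∀ t' : ComparisonTree k, t.cost a ≤ t'.cost a

/-! ### The input

The input is a permutation `σ` of `n` elements. Positions and elements are numbered from `0`: the
pivots are the entries at the positions `0, …, k - 1`, the entries at the positions `k, …, n - 1`
have to be classified. -/

/-- The entry of the input `σ` at position `j` (only used for `j < n`). -/
def entry {n : ℕ} (σ : Equiv.Perm (Fin n)) (j : ℕ) : ℕ :=
  if h : j < n then (σ ⟨j, h⟩ : ℕ) else 0

/-- The group of the (non-pivot) element at position `j`: it is `A_h`, that is, the element lies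
between the `h`-th and the `(h + 1)`-st smallest pivot, iff exactly `h` of the `k` pivots are
smaller. -/
def group (k : ℕ) {n : ℕ} (σ : Equiv.Perm (Fin n)) (j : ℕ) : Fin (k + 1) :=
  ⟨((Finset.range k).filter fun i => entry σ i < entry σ j).card,
    Nat.lt_succ_of_le ((Finset.card_filter_le _ _).trans (Finset.card_range k).le)⟩

/-- The group sizes `a_0, …, a_k` of the input `σ`. -/
def groupSizes (k : ℕ) {n : ℕ} (σ : Equiv.Perm (Fin n)) (h : Fin (k + 1)) : ℕ :=
  ((Finset.Ico k n).filter fun j => group k σ j = h).card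

/-! ### Classification trees and strategies -/

/-- A classification tree for inputs of length `n` and `k` pivots. It is a `(k + 1)`-way tree with
`n - k` levels of inner nodes. A node is identified with the sequence of edge labels on the path
from the root to it, so that the inner nodes are the lists `v` with `v.length < n - k` (values at
other lists are irrelevant). An inner node carries the position of the element that is classified
there and the comparison tree used for it. On each path from the root to a leaf every non-pivot
position occurs exactly once. -/
structure ClassificationTree (n k : ℕ) where
  index : List (Fin (k + 1)) → ℕ
  tree : List (Fin (k + 1)) → ComparisonTree k
  index_bijOn : ∀ w : List (Fin (k + 1)), w.length = n - k →
    Set.BijOn (fun l => index (w.take l)) (Set.Iio (n - k)) (Set.Ico k n)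

/-- The node on level `l` of the classification tree that is reached by the input `σ`. -/
def ClassificationTree.path {n k : ℕ} (T : ClassificationTree n k) (σ : Equiv.Perm (Fin n)) :
    ℕ → List (Fin (k + 1))
  | 0 => []
  | l + 1 => T.path σ l ++ [group k σ (T.index (T.path σ l))]

/-- The number of comparisons made when the input `σ` is classified with the classification
tree `T`. -/
def ClassificationTree.comparisons {n k : ℕ} (T : ClassificationTree n k)
    (σ : Equiv.Perm (Fin n)) : ℕ :=
  ∑ l ∈ Finset.range (n - k),
    (T.tree (T.path σ l)).depth (group k σ (T.index (T.path σ l)))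

/-- A (possibly unrealistic) strategy: the classification tree may depend on the group sizes
`a_0, …, a_k` of the input, equivalently on the pivots. A realizable strategy is one that does not
depend on them. -/
abbrev Strategy (n k : ℕ) : Type := (Fin (k + 1) → ℕ) → ClassificationTree n k

/-- The expected number of comparisons for classifying a uniformly random permutation. -/
noncomputable def Strategy.expectedComparisons {n k : ℕ} (S : Strategy n k) : ℝ :=
  𝔼 σ : Equiv.Perm (Fin n), ((S (groupSizes k σ)).comparisons σ : ℝ)

/-- The implementations of the strategy `O_k` on inputs of length `n`: given the group sizes `a`, at
every inner node `v` the comparison tree has minimum cost with respect to `a_h - a_h^v`, where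
`a_h^v` is the number of edges labeled `h` on the path to `v`. Only nodes with `a_h^v ≤ a_h` can be
reached; nothing is required of the others. The order of classification and the way in which ties
are broken are arbitrary. -/
def strategyO (n k : ℕ) : Set (Strategy n k) :=
  {S | ∀ a : Fin (k + 1) → ℕ, ∑ h, a h = n - k →
    ∀ v : List (Fin (k + 1)), v.length < n - k → (∀ h, v.count h ≤ a h) →
      ((S a).tree v).IsCostMinimal fun h => a h - v.count h}

/-- The implementations of the strategy `C_k` on inputs of length `n`: the classification tree does
not depend on the group sizes, and at every inner node `v` the comparison tree has minimum cost with
respect to the numbers `a_h^v` of elements already classified as belonging to `A_h`. The order of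
classification and the way in which ties are broken are arbitrary. -/
def strategyC (n k : ℕ) : Set (Strategy n k) :=
  {S | ∃ T : ClassificationTree n k, (∀ a, S a = T) ∧
    ∀ v : List (Fin (k + 1)), v.length < n - k → (T.tree v).IsCostMinimal fun h => v.count h}

/-- The expected comparison counts of the `k`-pivot strategies in `A n` and of `O_k` differ by at
most `c * n ^ s`, with a constant `c` that depends on nothing but `k`, `A` and `s`. -/
def WithinOfO (k : ℕ) (A : ∀ n, Set (Strategy n k)) (s : ℝ) : Prop :=
  ∃ c : ℝ, ∀ n : ℕ, ∀ S ∈ A n, ∀ O ∈ strategyO n k,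
    |S.expectedComparisons - O.expectedComparisons| ≤ c * (n : ℝ) ^ s

/-- Asymptotic optimality: the expected comparison count differs from that of `O_k` by
`O(n ^ (1 - ε))` for some constant `ε > 0`. -/
def AsymptoticallyOptimal (k : ℕ) (A : ∀ n, Set (Strategy n k)) : Prop :=
  ∃ ε : ℝ, 0 < ε ∧ WithinOfO k A (1 - ε)

end MultiPivot

/-!
The idea is to fix the group sizes `a_0, …, a_k` and to compare the two strategies level by level.
Put `N = n - k`.

*One step.* Exchanging two entries at positions that are not yet classified changes neither the
group sizes nor the path to the current node. Hence, given the path to a node `v` on level `l`, the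
next element belongs to `A_h` with probability `(a_h - a_h^v) / (N - l)`, whatever the order of
classification (`ClassificationTree.sum_path_group`). It follows that the distribution of the path
is the same for all classification trees (`ClassificationTree.sum_path_eq_sum_path`), so that both
strategies may be evaluated along one random path, and that the expected number of comparisons
at `v` is `cost (a - a^v) / (N - l)` (`ClassificationTree.sum_comparisons`).

*Loss at a node.* The tree of `O_k` is optimal for `a - a^v` and the tree of `C_k` is optimal for
`a^v`. If these two vectors are nearly proportional, the latter tree is nearly optimal for the
former vector: since depths are at most `k`, the loss at `v` is at most
`k ∑_h |D_h| / (l (N - l))` with `D_h = l a_h - N a_h^v`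
(`ComparisonTree.IsCostMinimal.mul_cost_sub_cost_le`).

*Concentration.* The second moment of `D_h` follows a recursion by the one-step law, which yields
`E D_h² ≤ 2 N l (N - l)` (`ClassificationTree.sum_deviation_sq_le`). By the Cauchy-Schwarz inequality
the expected loss on level `l` is `O(1 / √(l + 1) + 1 / √(N - l))`, and the sum over all levels is
`O(√n)`, so every exponent `s ≥ 1 / 2` is admissible.
-/

namespace MultiPivot

open Finset

/-! ### Comparison trees -/

theorem leafDepth_le_numNodes (t : BinaryTree Unit) (h : ℕ) : leafDepth t h ≤ t.numNodes := by
  induction t generalizing h with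
  | nil => simp [leafDepth]
  | node _ l r ihl ihr =>
    have h1 := ihl h
    have h2 := ihr (h - (l.numNodes + 1))
    simp only [leafDepth, BinaryTree.numNodes]
    split_ifs <;> omega

theorem ComparisonTree.depth_le {k : ℕ} (t : ComparisonTree k) (h : Fin (k + 1)) :
    t.depth h ≤ k :=
  (leafDepth_le_numNodes t.1 h).trans t.2.le

theorem ComparisonTree.abs_depth_sub_depth_le {k : ℕ} (t t' : ComparisonTree k)
    (h : Fin (k + 1)) : |(t.depth h : ℝ) - t'.depth h| ≤ k := by
  have h1 : (t.depth h : ℝ) ≤ k := mod_cast t.depth_le h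
  have h2 : (t'.depth h : ℝ) ≤ k := mod_cast t'.depth_le h
  rw [abs_le]
  constructor <;> linarith [(t.depth h).cast_nonneg (α := ℝ), (t'.depth h).cast_nonneg (α := ℝ)]

/-- A tree `t` that is optimal for the counts `c` is nearly optimal for the counts `r` if `c` and
`r` are nearly proportional: the loss against any `t'` is controlled by the `2 × 2` minors
`L * r h - M * c h`, where `L` and `M` are arbitrary weights. -/
theorem ComparisonTree.IsCostMinimal.mul_cost_sub_cost_le {k : ℕ} {t : ComparisonTree k}
    {c : Fin (k + 1) → ℕ} (ht : t.IsCostMinimal c) (t' : ComparisonTree k)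
    (r : Fin (k + 1) → ℕ) (L M : ℕ) :
    (L : ℝ) * ((t.cost r : ℝ) - t'.cost r) ≤ k * ∑ h, |(L : ℝ) * r h - M * c h| := by
  have hle : (M : ℝ) * t.cost c ≤ M * t'.cost c := by
    have := ht t'
    gcongr
  calc (L : ℝ) * ((t.cost r : ℝ) - t'.cost r)
      ≤ L * ((t.cost r : ℝ) - t'.cost r) - M * ((t.cost c : ℝ) - t'.cost c) := by linarith
    _ = ∑ h, ((t.depth h : ℝ) - t'.depth h) * (L * r h - M * c h) := by
      simp only [ComparisonTree.cost, Nat.cast_sum, Nat.cast_mul, ← Finset.sum_sub_distrib,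
        Finset.mul_sum]
      exact Finset.sum_congr rfl fun h _ => by ring
    _ ≤ ∑ h, k * |(L : ℝ) * r h - M * c h| := by
      refine Finset.sum_le_sum fun h _ => (le_abs_self _).trans ?_
      rw [abs_mul]
      gcongr
      exact t.abs_depth_sub_depth_le t' h
    _ = _ := by rw [Finset.mul_sum]

/-! ### Exchanging entries of the input -/

section SwapEntries

variable {n k : ℕ}

/-- The input `σ` with the entries at the positions `i` and `j` exchanged; it is `σ` itself unless
both positions are less than `n`. -/
def swapEntries (σ : Equiv.Perm (Fin n)) (i j : ℕ) : Equiv.Perm (Fin n) :=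
  if h : i < n ∧ j < n then σ * Equiv.swap ⟨i, h.1⟩ ⟨j, h.2⟩ else σ

theorem swapEntries_swapEntries (σ : Equiv.Perm (Fin n)) (i j : ℕ) :
    swapEntries (swapEntries σ i j) i j = σ := by
  unfold swapEntries
  split_ifs <;> simp [mul_assoc]

theorem entry_swapEntries (σ : Equiv.Perm (Fin n)) {i j : ℕ} (hi : i < n) (hj : j < n) (m : ℕ) :
    entry (swapEntries σ i j) m = entry σ (Equiv.swap i j m) := by
  simp only [entry, swapEntries, hi, hj, and_self, dite_true, Equiv.swap_apply_def]
  split_ifs <;> simp_all [Equiv.swap_apply_def]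

theorem group_swapEntries (σ : Equiv.Perm (Fin n)) {i j : ℕ} (hi : i ∈ Ico k n)
    (hj : j ∈ Ico k n) (m : ℕ) :
    group k (swapEntries σ i j) m = group k σ (Equiv.swap i j m) := by
  rw [mem_Ico] at hi hj
  simp only [group, entry_swapEntries σ hi.2 hj.2, Fin.mk.injEq]
  congr 1
  refine filter_congr fun p hp => ?_
  rw [mem_range] at hp
  rw [Equiv.swap_apply_of_ne_of_ne (a := i) (b := j) (x := p) (by omega) (by omega)]

theorem groupSizes_swapEntries (σ : Equiv.Perm (Fin n)) {i j : ℕ} (hi : i ∈ Ico k n)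
    (hj : j ∈ Ico k n) : groupSizes k (swapEntries σ i j) = groupSizes k σ := by
  funext h
  have key : ∀ m, m ∈ Ico k n ↔ Equiv.swap i j m ∈ Ico k n := fun m => by
    rw [Equiv.swap_apply_def]
    split_ifs <;> simp_all
  refine card_equiv (Equiv.swap i j) fun m => ?_
  rw [mem_filter, mem_filter, ← key, group_swapEntries σ hi hj]

end SwapEntries

/-! ### The positions that are not yet classified -/

theorem sum_groupSizes {n k : ℕ} (σ : Equiv.Perm (Fin n)) : ∑ h, groupSizes k σ h = n - k := by
  simp only [groupSizes]
  rw [← card_eq_sum_card_fiberwise (fun _ _ => mem_coe.2 (mem_univ _)), Nat.card_Ico]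

namespace ClassificationTree

variable {n k : ℕ} (T : ClassificationTree n k)

theorem length_path (σ : Equiv.Perm (Fin n)) (l : ℕ) : (T.path σ l).length = l := by
  induction l with
  | zero => rfl
  | succ l ih => simp [path, ih]

theorem take_path (σ : Equiv.Perm (Fin n)) {i l : ℕ} (h : i ≤ l) :
    (T.path σ l).take i = T.path σ i := by
  induction l, h using Nat.le_induction with
  | base => simp [List.take_of_length_le, length_path]
  | succ l hl ih => rw [path, List.take_append_of_le_length (by simpa [length_path]), ih]

theorem injOn_index_path (σ : Equiv.Perm (Fin n)) :
    Set.InjOn (fun i => T.index (T.path σ i)) (Set.Iio (n - k)) := by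
  refine (T.index_bijOn (T.path σ (n - k)) (T.length_path σ _)).injOn.congr fun i hi => ?_
  simp only [T.take_path σ (Set.mem_Iio.1 hi).le]

theorem index_path_mem (σ : Equiv.Perm (Fin n)) {l : ℕ} (hl : l < n - k) :
    T.index (T.path σ l) ∈ Ico k n := by
  have := (T.index_bijOn (T.path σ (n - k)) (T.length_path σ _)).mapsTo (Set.mem_Iio.2 hl)
  simpa [T.take_path σ hl.le] using this

/-- The non-pivot positions that the input `σ` has not yet classified when it reaches level `l`. -/
def unclassified (σ : Equiv.Perm (Fin n)) (l : ℕ) : Finset ℕ :=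
  Ico k n \ (range l).image fun i => T.index (T.path σ i)

theorem image_index_path_subset (σ : Equiv.Perm (Fin n)) {l : ℕ} (hl : l ≤ n - k) :
    ((range l).image fun i => T.index (T.path σ i)) ⊆ Ico k n := by
  intro j hj
  obtain ⟨i, hi, rfl⟩ := mem_image.1 hj
  exact T.index_path_mem σ ((mem_range.1 hi).trans_le hl)

theorem index_path_mem_unclassified (σ : Equiv.Perm (Fin n)) {l : ℕ} (hl : l < n - k) :
    T.index (T.path σ l) ∈ T.unclassified σ l := by
  refine mem_sdiff.2 ⟨T.index_path_mem σ hl, fun h => ?_⟩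
  obtain ⟨i, hi, he⟩ := mem_image.1 h
  rw [mem_range] at hi
  exact hi.ne (T.injOn_index_path σ (Set.mem_Iio.2 (hi.trans hl)) (Set.mem_Iio.2 hl) he)

theorem injOn_index_path_range (σ : Equiv.Perm (Fin n)) {l : ℕ} (hl : l ≤ n - k) :
    Set.InjOn (fun i => T.index (T.path σ i)) (range l : Set ℕ) :=
  (T.injOn_index_path σ).mono fun i hi => by
    rw [mem_coe, mem_range] at hi
    exact hi.trans_le hl

theorem card_unclassified (σ : Equiv.Perm (Fin n)) {l : ℕ} (hl : l ≤ n - k) :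
    (T.unclassified σ l).card = n - k - l := by
  rw [unclassified, card_sdiff_of_subset (T.image_index_path_subset σ hl),
    card_image_of_injOn (T.injOn_index_path_range σ hl), Nat.card_Ico, card_range]

theorem sum_group_index_path (σ : Equiv.Perm (Fin n)) (l : ℕ) (φ : Fin (k + 1) → ℝ) :
    ∑ i ∈ range l, φ (group k σ (T.index (T.path σ i))) =
      ∑ h, φ h * (T.path σ l).count h := by
  induction l with
  | zero => simp [path]
  | succ l ih =>
    rw [sum_range_succ, ih, path]
    simp [List.count_append, List.count_singleton, mul_add, sum_add_distrib]

theorem sum_group_unclassified (σ : Equiv.Perm (Fin n)) {l : ℕ} (hl : l ≤ n - k)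
    (φ : Fin (k + 1) → ℝ) :
    ∑ j ∈ T.unclassified σ l, φ (group k σ j) =
      ∑ h, φ h * ((groupSizes k σ h : ℝ) - (T.path σ l).count h) := by
  have h1 : ∑ j ∈ Ico k n, φ (group k σ j) = ∑ h, φ h * groupSizes k σ h := by
    rw [← sum_fiberwise (Ico k n) (fun j => group k σ j)]
    refine sum_congr rfl fun h _ => ?_
    rw [sum_congr rfl (g := fun _ => φ h) fun j hj => by rw [(mem_filter.1 hj).2]]
    simp [groupSizes, mul_comm]
  have h2 := sum_sdiff (f := fun j => φ (group k σ j)) (T.image_index_path_subset σ hl)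
  rw [sum_image (T.injOn_index_path_range σ hl), T.sum_group_index_path, h1] at h2
  simp only [mul_sub, sum_sub_distrib]
  exact eq_sub_of_add_eq h2

theorem count_path_le (σ : Equiv.Perm (Fin n)) {l : ℕ} (hl : l ≤ n - k) (h : Fin (k + 1)) :
    (T.path σ l).count h ≤ groupSizes k σ h := by
  have := T.sum_group_unclassified σ hl fun h' => if h' = h then 1 else 0
  simp only [ite_mul, one_mul, zero_mul, sum_ite_eq', mem_univ, if_true] at this
  have hnonneg : (0 : ℝ) ≤ groupSizes k σ h - (T.path σ l).count h :=
    this ▸ sum_nonneg fun j _ => by positivity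
  exact_mod_cast sub_nonneg.1 hnonneg

/-- An exchange of two unclassified entries does not change the way to the current node. -/
theorem path_swapEntries (σ : Equiv.Perm (Fin n)) {l i j : ℕ} (hi : i ∈ T.unclassified σ l)
    (hj : j ∈ T.unclassified σ l) {m : ℕ} (hm : m ≤ l) :
    T.path (swapEntries σ i j) m = T.path σ m := by
  rw [unclassified, mem_sdiff] at hi hj
  induction m with
  | zero => rfl
  | succ m ih =>
    have hne : ∀ p, p ∉ ((range l).image fun i => T.index (T.path σ i)) →
        T.index (T.path σ m) ≠ p :=
      fun p hp he => hp (mem_image.2 ⟨m, mem_range.2 hm, he⟩)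
    rw [path, path, ih (by omega), group_swapEntries σ hi.1 hj.1,
      Equiv.swap_apply_of_ne_of_ne (hne i hi.2) (hne j hj.2)]

theorem unclassified_swapEntries (σ : Equiv.Perm (Fin n)) {l i j : ℕ}
    (hi : i ∈ T.unclassified σ l) (hj : j ∈ T.unclassified σ l) :
    T.unclassified (swapEntries σ i j) l = T.unclassified σ l := by
  unfold unclassified
  congr 1
  refine image_congr fun m hm => ?_
  simp only [T.path_swapEntries σ hi hj (mem_range.1 (mem_coe.1 hm)).le]

end ClassificationTree

/-! ### The distribution of the path of a random input -/

/-- The inputs with given group sizes `a`. -/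
def inputs (n k : ℕ) (a : Fin (k + 1) → ℕ) : Finset (Equiv.Perm (Fin n)) :=
  univ.filter fun σ => groupSizes k σ = a

theorem mem_inputs {n k : ℕ} {a : Fin (k + 1) → ℕ} {σ : Equiv.Perm (Fin n)} :
    σ ∈ inputs n k a ↔ groupSizes k σ = a := by
  simp [inputs]

namespace ClassificationTree

variable {n k : ℕ} (T : ClassificationTree n k) (a : Fin (k + 1) → ℕ)

/-- Given the group sizes and the path to a node on level `l`, all unclassified positions are
exchangeable, so the entry that is classified next belongs to `A_h` with probability
`(a_h - a_h^v) / (n - k - l)`. -/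
theorem sum_path_group {l : ℕ} (hl : l < n - k) (f : List (Fin (k + 1)) → Fin (k + 1) → ℝ) :
    ∑ σ ∈ inputs n k a, f (T.path σ l) (group k σ (T.index (T.path σ l))) =
      ∑ σ ∈ inputs n k a,
        (∑ h, f (T.path σ l) h * ((a h : ℝ) - (T.path σ l).count h)) / (n - k - l : ℕ) := by
  have hM : ((n - k - l : ℕ) : ℝ) ≠ 0 := by
    have : n - k - l ≠ 0 := by omega
    exact_mod_cast this
  rw [← sum_div, eq_div_iff hM]
  have h1 : ∑ σ ∈ inputs n k a, ∑ h, f (T.path σ l) h * ((a h : ℝ) - (T.path σ l).count h) =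
      ∑ σ ∈ inputs n k a, ∑ j ∈ T.unclassified σ l, f (T.path σ l) (group k σ j) := by
    refine sum_congr rfl fun σ hσ => ?_
    rw [T.sum_group_unclassified σ hl.le, mem_inputs.1 hσ]
  have h2 : (∑ σ ∈ inputs n k a, f (T.path σ l) (group k σ (T.index (T.path σ l)))) *
        (n - k - l : ℕ) = ∑ σ ∈ inputs n k a, ∑ j ∈ T.unclassified σ l,
          f (T.path σ l) (group k σ (T.index (T.path σ l))) := by
    rw [sum_mul]
    refine sum_congr rfl fun σ _ => ?_
    rw [sum_const, T.card_unclassified σ hl.le, nsmul_eq_mul, mul_comm]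
  rw [h1, h2, sum_sigma', sum_sigma']
  -- the involution that exchanges the entry at the unclassified position with the next entry
  let e : (Σ _ : Equiv.Perm (Fin n), ℕ) → Σ _ : Equiv.Perm (Fin n), ℕ :=
    fun x => ⟨swapEntries x.1 x.2 (T.index (T.path x.1 l)), x.2⟩
  have he : ∀ x ∈ (inputs n k a).sigma (fun σ => T.unclassified σ l),
      e x ∈ (inputs n k a).sigma (fun σ => T.unclassified σ l) ∧
        T.path (e x).1 l = T.path x.1 l := by
    rintro ⟨σ, j⟩ hx
    obtain ⟨hσ, hj⟩ := mem_sigma.1 hx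
    have hi := T.index_path_mem_unclassified σ hl
    refine ⟨mem_sigma.2 ⟨mem_inputs.2 ?_, ?_⟩, T.path_swapEntries σ hj hi le_rfl⟩
    · rw [groupSizes_swapEntries σ (mem_sdiff.1 hj).1 (mem_sdiff.1 hi).1, mem_inputs.1 hσ]
    · simpa only [e, T.unclassified_swapEntries σ hj hi] using hj
  have hee : ∀ x ∈ (inputs n k a).sigma (fun σ => T.unclassified σ l), e (e x) = x := by
    rintro ⟨σ, j⟩ hx
    have := (he _ hx).2
    simp only [e] at this ⊢
    rw [this, swapEntries_swapEntries]
  refine sum_bij' (fun x _ => e x) (fun x _ => e x) (fun x hx => (he x hx).1)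
    (fun x hx => (he x hx).1) hee hee ?_
  rintro ⟨σ, j⟩ hx
  have hj := (mem_sigma.1 hx).2
  have hi := T.index_path_mem_unclassified σ hl
  simp only [(he _ hx).2]
  simp only [e]
  rw [group_swapEntries σ (mem_sdiff.1 hj).1 (mem_sdiff.1 hi).1, Equiv.swap_apply_left]

/-- The distribution of the path does not depend on the classification tree. -/
theorem sum_path_eq_sum_path (T' : ClassificationTree n k) {l : ℕ} (hl : l ≤ n - k)
    (g : List (Fin (k + 1)) → ℝ) :
    ∑ σ ∈ inputs n k a, g (T.path σ l) = ∑ σ ∈ inputs n k a, g (T'.path σ l) := by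
  induction l generalizing g with
  | zero => simp [path]
  | succ l ih =>
    simp only [path]
    rw [T.sum_path_group a (by omega) fun v h => g (v ++ [h]),
      T'.sum_path_group a (by omega) fun v h => g (v ++ [h])]
    exact ih (by omega) fun v =>
      (∑ h, g (v ++ [h]) * ((a h : ℝ) - v.count h)) / (n - k - l : ℕ)

theorem sum_comparisons :
    ∑ σ ∈ inputs n k a, (T.comparisons σ : ℝ) =
      ∑ l ∈ range (n - k), ∑ σ ∈ inputs n k a,
        ((T.tree (T.path σ l)).cost (fun h => a h - (T.path σ l).count h) : ℝ) /
          (n - k - l : ℕ) := by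
  simp only [comparisons, Nat.cast_sum]
  rw [sum_comm]
  refine sum_congr rfl fun l hl => ?_
  rw [mem_range] at hl
  rw [T.sum_path_group a hl fun v h => ((T.tree v).depth h : ℝ)]
  refine sum_congr rfl fun σ hσ => ?_
  simp only [ComparisonTree.cost, Nat.cast_sum, Nat.cast_mul]
  congr 1
  refine sum_congr rfl fun h _ => ?_
  have := T.count_path_le σ hl.le h
  rw [mem_inputs.1 hσ] at this
  rw [Nat.cast_sub this]

end ClassificationTree

/-! ### Concentration of the group counts -/

namespace ClassificationTree

variable {n k : ℕ} (T : ClassificationTree n k) (a : Fin (k + 1) → ℕ)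

/-- The deviation `D_l = l a_h - N a_h^v` on level `l`, where `N = n - k`. Multiplied by
`1 / (l (N - l))` it is the difference between the share of `A_h` among the elements still to be
classified and its share among those already classified. -/
def deviation (h : Fin (k + 1)) (v : List (Fin (k + 1))) (l : ℕ) : ℝ :=
  (l : ℝ) * a h - (n - k : ℕ) * v.count h

theorem deviation_append_singleton (h i : Fin (k + 1)) (v : List (Fin (k + 1))) (l : ℕ) :
    deviation (n := n) a h (v ++ [i]) (l + 1) =
      deviation (n := n) a h v l + a h - (n - k : ℕ) * if i = h then 1 else 0 := by
  simp only [deviation, List.count_append, List.count_singleton, beq_iff_eq]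
  push_cast
  ring

/-- The deviation has a drift towards `0`: given a node with `M` elements left, the expectation of
`D_{l + 1}²` is at most `(1 - 2 / M) D_l² + N²`, and this gives the bound by induction. -/
theorem sum_deviation_sq_le (h : Fin (k + 1)) {l : ℕ} (hl : l < n - k) :
    ∑ σ ∈ inputs n k a, deviation (n := n) a h (T.path σ l) l ^ 2 ≤
      2 * (n - k : ℕ) * l * (n - k - l : ℕ) * (inputs n k a).card := by
  induction l with
  | zero => simp [path, deviation]
  | succ l ih =>
    have ih := ih (by omega)
    have hMN : ((n - k - l : ℕ) : ℝ) = (n - k : ℕ) - l := Nat.cast_sub (by omega)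
    have hMN' : ((n - k - (l + 1) : ℕ) : ℝ) = (n - k : ℕ) - (l + 1) := by
      rw [Nat.cast_sub (by omega)]; push_cast; ring
    have hM2 : (2 : ℝ) ≤ (n - k - l : ℕ) := by
      have : 2 ≤ n - k - l := by omega
      exact_mod_cast this
    have hN2 : (2 : ℝ) ≤ (n - k : ℕ) := by
      have : 2 ≤ n - k := by omega
      exact_mod_cast this
    have step : ∑ σ ∈ inputs n k a, deviation (n := n) a h (T.path σ (l + 1)) (l + 1) ^ 2 ≤
        ∑ σ ∈ inputs n k a, ((1 - 2 / (n - k - l : ℕ)) *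
          deviation (n := n) a h (T.path σ l) l ^ 2 + ((n - k : ℕ) : ℝ) ^ 2) := by
      simp only [path]
      rw [T.sum_path_group a (by omega) fun v i =>
        deviation (n := n) a h (v ++ [i]) (l + 1) ^ 2]
      refine sum_le_sum fun σ hσ => ?_
      have hsum := T.sum_group_unclassified σ (l := l) (by omega) fun _ => 1
      have hcard := T.card_unclassified σ (l := l) (by omega)
      have hc := T.count_path_le σ (l := l) (by omega)
      have hle : a h ≤ n - k := by
        rw [← sum_groupSizes σ, mem_inputs.1 hσ]
        exact single_le_sum (fun _ _ => Nat.zero_le _) (mem_univ h)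
      rw [mem_inputs.1 hσ] at hsum hc
      simp only [sum_const, hcard, nsmul_eq_mul, mul_one, one_mul] at hsum
      set r : Fin (k + 1) → ℝ := fun i => (a i : ℝ) - (T.path σ l).count i with hr
      have hr0 : ∀ i, 0 ≤ r i := fun i => sub_nonneg.2 (mod_cast hc i)
      have hrM : r h ≤ (n - k - l : ℕ) := by
        rw [hsum]
        exact single_le_sum (fun i _ => hr0 i) (mem_univ h)
      have hA : (a h : ℝ) ≤ (n - k : ℕ) := mod_cast hle
      have hA0 : (0 : ℝ) ≤ a h := Nat.cast_nonneg _
      have hrest : ∑ i ∈ univ.erase h, r i = (n - k - l : ℕ) - r h := by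
        rw [hsum, ← add_sum_erase _ _ (mem_univ h)]; ring
      set D := deviation (n := n) a h (T.path σ l) l with hD
      have hDr : D = (n - k : ℕ) * r h - (n - k - l : ℕ) * a h := by
        rw [hD, hr, hMN, deviation]; ring
      have hexp : ∑ i, deviation (n := n) a h (T.path σ l ++ [i]) (l + 1) ^ 2 * r i =
          (D + a h - (n - k : ℕ)) ^ 2 * r h + (D + a h) ^ 2 * ((n - k - l : ℕ) - r h) := by
        rw [← add_sum_erase _ _ (mem_univ h), ← hrest, mul_sum]
        congr 1
        · rw [deviation_append_singleton, if_pos rfl, mul_one]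
        · refine sum_congr rfl fun i hi => ?_
          rw [deviation_append_singleton, if_neg (ne_of_mem_erase hi), mul_zero, sub_zero]
      rw [hexp, div_le_iff₀ (by linarith)]
      have hM0 : ((n - k - l : ℕ) : ℝ) ≠ 0 := by linarith
      have hfac : (1 - 2 / ((n - k - l : ℕ) : ℝ)) * D ^ 2 * (n - k - l : ℕ) =
          ((n - k - l : ℕ) - 2) * D ^ 2 := by field_simp
      rw [add_mul, hfac]
      have h1 : ((a h : ℝ) - (n - k : ℕ)) ^ 2 ≤ ((n - k : ℕ) : ℝ) ^ 2 :=
        sq_le_sq' (by linarith) (by linarith)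
      have h2 : (a h : ℝ) ^ 2 ≤ ((n - k : ℕ) : ℝ) ^ 2 := by gcongr
      have h3 := mul_le_mul_of_nonneg_right h1 (hr0 h)
      have h4 := mul_le_mul_of_nonneg_right h2 (sub_nonneg.2 hrM)
      have h5 : D * ((a h : ℝ) * (n - k - l : ℕ) - (n - k : ℕ) * r h) = -D ^ 2 := by
        have : (a h : ℝ) * (n - k - l : ℕ) - (n - k : ℕ) * r h = -D := by rw [hDr]; ring
        rw [this]; ring
      linarith
    refine step.trans ?_
    rw [sum_add_distrib, ← mul_sum, sum_const, nsmul_eq_mul, hMN']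
    have hcoef : 0 ≤ 1 - 2 / ((n - k - l : ℕ) : ℝ) := by
      rw [sub_nonneg, div_le_one (by linarith)]
      exact hM2
    refine (add_le_add_left (mul_le_mul_of_nonneg_left ih hcoef) _).trans ?_
    have hM0 : ((n - k - l : ℕ) : ℝ) ≠ 0 := by linarith
    have hfac : (1 - 2 / ((n - k - l : ℕ) : ℝ)) *
        (2 * (n - k : ℕ) * l * (n - k - l : ℕ) * (inputs n k a).card) =
        2 * (n - k : ℕ) * l * ((n - k - l : ℕ) - 2) * (inputs n k a).card := by field_simp
    rw [hfac, hMN]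
    have h6 : 0 ≤ ((n - k : ℕ) : ℝ) * ((n - k : ℕ) - 2) * (inputs n k a).card := by
      have : (0 : ℝ) ≤ (n - k : ℕ) - 2 := by linarith
      positivity
    push_cast
    linarith

theorem sum_abs_deviation_le (h : Fin (k + 1)) {l : ℕ} (hl0 : 0 < l) (hl : l < n - k) :
    ∑ σ ∈ inputs n k a, |deviation (n := n) a h (T.path σ l) l| ≤
      l * (n - k - l : ℕ) * (2 / √(l + 1 : ℕ) + 2 / √(n - k - l : ℕ)) *
        (inputs n k a).card := by
  have hsq : (∑ σ ∈ inputs n k a, |deviation (n := n) a h (T.path σ l) l|) ^ 2 ≤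
      (inputs n k a).card * ∑ σ ∈ inputs n k a, deviation (n := n) a h (T.path σ l) l ^ 2 := by
    simpa only [sq_abs] using sq_sum_le_card_mul_sum_sq (s := inputs n k a)
      (f := fun σ => |deviation (n := n) a h (T.path σ l) l|)
  have hdev := T.sum_deviation_sq_le a h hl
  have hMN : ((n - k : ℕ) : ℝ) = (n - k - l : ℕ) + l := by
    rw [Nat.cast_sub hl.le]; ring
  have hl1 : (1 : ℝ) ≤ l := by exact_mod_cast hl0
  have hM1 : (1 : ℝ) ≤ (n - k - l : ℕ) := by
    have : 1 ≤ n - k - l := by omega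
    exact_mod_cast this
  rw [hMN] at hdev
  set M : ℝ := ((n - k - l : ℕ) : ℝ)
  set F : ℝ := ((inputs n k a).card : ℝ)
  have hF : 0 ≤ F := Nat.cast_nonneg _
  have hroot : 2 * (M + l) ≤ l * M * (2 / √(l + 1 : ℕ) + 2 / √M) ^ 2 := by
    have e1 : (2 / √(l + 1 : ℕ)) ^ 2 = 4 / ((l : ℝ) + 1) := by
      rw [div_pow, Real.sq_sqrt (Nat.cast_nonneg _)]; push_cast; norm_num
    have e2 : (2 / √M) ^ 2 = 4 / M := by
      rw [div_pow, Real.sq_sqrt (by linarith)]; norm_num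
    have e3 : 4 / ((l : ℝ) + 1) + 4 / M ≤ (2 / √(l + 1 : ℕ) + 2 / √M) ^ 2 := by
      rw [add_sq, e1, e2]
      have : 0 ≤ 2 * (2 / √(l + 1 : ℕ)) * (2 / √M) := by positivity
      linarith
    have e4 : 2 / (l : ℝ) ≤ 4 / (l + 1) := by
      rw [div_le_div_iff₀ (by linarith) (by linarith)]; linarith
    have e5 : (l : ℝ) * M * (2 / l + 4 / M) = 2 * M + 4 * l := by
      have : (l : ℝ) ≠ 0 := by linarith
      have : M ≠ 0 := by linarith
      field_simp
    calc 2 * (M + l) ≤ l * M * (2 / l + 4 / M) := by rw [e5]; linarith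
      _ ≤ l * M * (2 / √(l + 1 : ℕ) + 2 / √M) ^ 2 := by
        gcongr
        linarith
  refine (le_abs_self _).trans (abs_le_of_sq_le_sq (hsq.trans ?_) (by positivity))
  calc F * ∑ σ ∈ inputs n k a, deviation (n := n) a h (T.path σ l) l ^ 2
      ≤ F * (2 * (M + l) * l * M * F) := by gcongr
    _ = 2 * (M + l) * (l * M * F ^ 2) := by ring
    _ ≤ l * M * (2 / √(l + 1 : ℕ) + 2 / √M) ^ 2 * (l * M * F ^ 2) := by gcongr
    _ = _ := by ring

/-! ### Comparison of the two strategies -/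

variable {T a} {T' : ClassificationTree n k}

/-- The loss on a single level `l`. The summand `1` in `√(l + 1)` takes care of the root, where
nothing is known about the group sizes and the loss can be as large as `k`. -/
theorem sum_cost_sub_cost_le
    (hT : ∀ v : List (Fin (k + 1)), v.length < n - k → (T.tree v).IsCostMinimal fun h => v.count h)
    {l : ℕ} (hl : l < n - k) :
    ∑ σ ∈ inputs n k a,
        (((T.tree (T.path σ l)).cost (fun h => a h - (T.path σ l).count h) : ℝ) -
          (T'.tree (T.path σ l)).cost (fun h => a h - (T.path σ l).count h)) /
            (n - k - l : ℕ) ≤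
      k * (k + 1) * (2 / √(l + 1 : ℕ) + 2 / √(n - k - l : ℕ)) * (inputs n k a).card := by
  have hM0 : (0 : ℝ) < (n - k - l : ℕ) := by
    have : 0 < n - k - l := by omega
    exact_mod_cast this
  rw [← sum_div, div_le_iff₀ hM0]
  rcases Nat.eq_zero_or_pos l with rfl | hl0
  · have hroot : ∀ σ ∈ inputs n k a,
        ((T.tree (T.path σ 0)).cost (fun h => a h - (T.path σ 0).count h) : ℝ) -
          (T'.tree (T.path σ 0)).cost (fun h => a h - (T.path σ 0).count h) ≤
            k * (n - k - 0 : ℕ) := by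
      intro σ hσ
      have hcost : (T.tree (T.path σ 0)).cost (fun h => a h - (T.path σ 0).count h) ≤
          k * (n - k) := by
        rw [← sum_groupSizes σ, mem_inputs.1 hσ, mul_sum]
        refine sum_le_sum fun h _ => Nat.mul_le_mul (ComparisonTree.depth_le _ h) ?_
        exact Nat.sub_le _ _
      have hcost' : ((T.tree (T.path σ 0)).cost (fun h => a h - (T.path σ 0).count h) : ℝ) ≤
          k * (n - k - 0 : ℕ) := by exact_mod_cast hcost
      linarith [((T'.tree (T.path σ 0)).cost
        (fun h => a h - (T.path σ 0).count h)).cast_nonneg (α := ℝ)]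
    refine (sum_le_sum hroot).trans ?_
    rw [sum_const, nsmul_eq_mul]
    have hfac : (1 : ℝ) ≤ (k + 1) * (2 / √(0 + 1 : ℕ) + 2 / √(n - k - 0 : ℕ)) := by
      have h1 : (1 : ℝ) ≤ k + 1 := by linarith [k.cast_nonneg (α := ℝ)]
      have h2 : (0 : ℝ) ≤ 2 / √(n - k - 0 : ℕ) := by positivity
      have h3 : (1 : ℝ) ≤ 2 / √(0 + 1 : ℕ) + 2 / √(n - k - 0 : ℕ) := by
        have : 2 / √((0 + 1 : ℕ) : ℝ) = 2 := by simp
        linarith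
      exact one_le_mul_of_one_le_of_one_le h1 h3
    calc ((inputs n k a).card : ℝ) * (k * (n - k - 0 : ℕ))
        = (inputs n k a).card * (k * (n - k - 0 : ℕ)) * 1 := by ring
      _ ≤ (inputs n k a).card * (k * (n - k - 0 : ℕ)) *
          ((k + 1) * (2 / √(0 + 1 : ℕ) + 2 / √(n - k - 0 : ℕ))) := by gcongr
      _ = _ := by ring
  · have hl0' : (0 : ℝ) < l := by exact_mod_cast hl0
    refine le_of_mul_le_mul_left ?_ hl0'
    have hpoint : ∀ σ ∈ inputs n k a,
        (l : ℝ) * (((T.tree (T.path σ l)).cost (fun h => a h - (T.path σ l).count h) : ℝ) -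
          (T'.tree (T.path σ l)).cost (fun h => a h - (T.path σ l).count h)) ≤
            k * ∑ h, |deviation (n := n) a h (T.path σ l) l| := by
      intro σ hσ
      refine ((hT (T.path σ l) (by rwa [T.length_path])).mul_cost_sub_cost_le _ _ l
        (n - k - l)).trans_eq ?_
      congr 1
      refine sum_congr rfl fun h _ => ?_
      have := T.count_path_le σ hl.le h
      rw [mem_inputs.1 hσ] at this
      rw [Nat.cast_sub this, Nat.cast_sub hl.le, deviation]
      congr 1
      ring
    rw [mul_sum]
    refine (sum_le_sum hpoint).trans ?_
    rw [← mul_sum, sum_comm]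
    refine (mul_le_mul_of_nonneg_left (sum_le_sum fun h _ => T.sum_abs_deviation_le a h hl0 hl)
      k.cast_nonneg).trans_eq ?_
    rw [sum_const, card_univ, Fintype.card_fin, nsmul_eq_mul]
    push_cast
    ring

end ClassificationTree

theorem sum_one_div_sqrt_le (N : ℕ) : ∑ l ∈ range N, 1 / √(l + 1 : ℕ) ≤ 2 * √N := by
  induction N with
  | zero => simp
  | succ N ih =>
    rw [sum_range_succ]
    have hpos : 0 < √(N + 1 : ℕ) := Real.sqrt_pos.2 (by positivity)
    have h1 : √(N + 1 : ℕ) ^ 2 = N + 1 := by rw [Real.sq_sqrt (by positivity)]; push_cast; rfl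
    have h2 : √(N : ℝ) ^ 2 = N := Real.sq_sqrt (by positivity)
    have h3 : 1 / √(N + 1 : ℕ) ≤ 2 * √(N + 1 : ℕ) - 2 * √(N : ℝ) := by
      rw [div_le_iff₀ hpos]
      nlinarith [sq_nonneg (√(N + 1 : ℕ) - √(N : ℝ))]
    linarith

/-- For given group sizes the expected comparison counts of the two strategies differ by at most
`8 k (k + 1) √n`. -/
theorem ClassificationTree.abs_sum_comparisons_sub_le {n k : ℕ} {a : Fin (k + 1) → ℕ}
    {T T' : ClassificationTree n k}
    (hT : ∀ v : List (Fin (k + 1)), v.length < n - k → (T.tree v).IsCostMinimal fun h => v.count h)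
    (hT' : ∑ h, a h = n - k → ∀ v : List (Fin (k + 1)), v.length < n - k →
      (∀ h, v.count h ≤ a h) → (T'.tree v).IsCostMinimal fun h => a h - v.count h) :
    |∑ σ ∈ inputs n k a, ((T.comparisons σ : ℝ) - T'.comparisons σ)| ≤
      8 * k * (k + 1) * √n * (inputs n k a).card := by
  have hdiff : ∑ σ ∈ inputs n k a, ((T.comparisons σ : ℝ) - T'.comparisons σ) =
      ∑ l ∈ range (n - k), ∑ σ ∈ inputs n k a,
        (((T.tree (T.path σ l)).cost (fun h => a h - (T.path σ l).count h) : ℝ) -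
          (T'.tree (T.path σ l)).cost (fun h => a h - (T.path σ l).count h)) /
            (n - k - l : ℕ) := by
    rw [sum_sub_distrib, T.sum_comparisons, T'.sum_comparisons, ← sum_sub_distrib]
    refine sum_congr rfl fun l hl => ?_
    rw [T'.sum_path_eq_sum_path a T (mem_range.1 hl).le fun v =>
      ((T'.tree v).cost (fun h => a h - v.count h) : ℝ) / (n - k - l : ℕ), ← sum_sub_distrib]
    exact sum_congr rfl fun σ _ => by rw [sub_div]
  rw [hdiff, abs_of_nonneg]
  · refine (sum_le_sum fun l hl => sum_cost_sub_cost_le hT (mem_range.1 hl)).trans ?_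
    rw [← sum_mul, ← mul_sum, sum_add_distrib]
    have h1 : ∑ l ∈ range (n - k), 2 / √(l + 1 : ℕ) ≤ 4 * √n := by
      have h2 := sum_one_div_sqrt_le (n - k)
      have h3 : √((n - k : ℕ) : ℝ) ≤ √n := Real.sqrt_le_sqrt (mod_cast Nat.sub_le n k)
      calc ∑ l ∈ range (n - k), 2 / √(l + 1 : ℕ)
          = 2 * ∑ l ∈ range (n - k), 1 / √(l + 1 : ℕ) := by
            rw [mul_sum]; exact sum_congr rfl fun l _ => by ring
        _ ≤ 4 * √n := by linarith
    have h4 : ∑ l ∈ range (n - k), 2 / √(n - k - l : ℕ) =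
        ∑ l ∈ range (n - k), 2 / √(l + 1 : ℕ) := by
      rw [← sum_range_reflect]
      refine sum_congr rfl fun l hl => ?_
      rw [mem_range] at hl
      rw [show n - k - (n - k - 1 - l) = l + 1 by omega]
    rw [h4]
    calc (k : ℝ) * (k + 1) * (∑ l ∈ range (n - k), 2 / √(l + 1 : ℕ) +
          ∑ l ∈ range (n - k), 2 / √(l + 1 : ℕ)) * (inputs n k a).card
        ≤ k * (k + 1) * (4 * √n + 4 * √n) * (inputs n k a).card := by gcongr
      _ = _ := by ring
  · refine sum_nonneg fun l hl => sum_nonneg fun σ hσ => div_nonneg ?_ (Nat.cast_nonneg _)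
    rw [mem_range] at hl
    have ha := mem_inputs.1 hσ
    refine sub_nonneg.2 (Nat.cast_le.2 (hT' ?_ _ ?_ (fun h => ?_) _))
    · rw [← ha, sum_groupSizes]
    · rwa [T.length_path]
    · rw [← ha]
      exact T.count_path_le σ hl.le h

theorem abs_expectedComparisons_sub_le {n k : ℕ} {S O : Strategy n k} (hS : S ∈ strategyC n k)
    (hO : O ∈ strategyO n k) :
    |S.expectedComparisons - O.expectedComparisons| ≤ 8 * k * (k + 1) * √n := by
  obtain ⟨T, hST, hT⟩ := hS
  have hcard : (0 : ℝ) < (univ : Finset (Equiv.Perm (Fin n))).card := by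
    exact_mod_cast univ_nonempty.card_pos
  rw [Strategy.expectedComparisons, Strategy.expectedComparisons, ← expect_sub_distrib,
    expect_eq_sum_div_card, abs_div, abs_of_pos hcard, div_le_iff₀ hcard]
  have hmaps : ∀ σ ∈ (univ : Finset (Equiv.Perm (Fin n))),
      groupSizes k σ ∈ (univ : Finset (Equiv.Perm (Fin n))).image (groupSizes k) :=
    fun σ hσ => mem_image_of_mem _ hσ
  rw [← sum_fiberwise_of_maps_to hmaps, card_eq_sum_card_fiberwise hmaps, Nat.cast_sum, mul_sum]
  refine (abs_sum_le_sum_abs _ _).trans (sum_le_sum fun a _ => ?_)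
  have hfib := ClassificationTree.abs_sum_comparisons_sub_le (a := a) hT (hO a)
  refine le_of_eq_of_le ?_ hfib
  congr 1
  refine sum_congr rfl fun σ hσ => ?_
  rw [hST, (mem_filter.1 hσ).2]

theorem withinOfO_strategyC (k : ℕ) {s : ℝ} (hs : 1 / 2 ≤ s) :
    WithinOfO k (fun n => strategyC n k) s := by
  refine ⟨8 * k * (k + 1), fun n S hS O hO => (abs_expectedComparisons_sub_le hS hO).trans ?_⟩
  rcases Nat.eq_zero_or_pos n with rfl | hn
  · simp only [Nat.cast_zero, Real.sqrt_zero, mul_zero]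
    have := Real.rpow_nonneg (le_refl (0 : ℝ)) s
    positivity
  · gcongr
    rw [Real.sqrt_eq_rpow]
    exact Real.rpow_le_rpow_of_exponent_le (by exact_mod_cast hn) hs

end MultiPivot

theorem mainTheorem4 (k : ℕ) (hk : 1 ≤ k) :
    MultiPivot.AsymptoticallyOptimal k (fun n => MultiPivot.strategyC n k) ∧
      MultiPivot.WithinOfO k (fun n => MultiPivot.strategyC n k) (11 / 12) := by
  refine ⟨⟨1 / 2, by norm_num, ?_⟩, ?_⟩ <;>
    exact MultiPivot.withinOfO_strategyC k (by norm_num)
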